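/- Let $d\ge 3$, let $U(d)$ be the group of $d\times d$ complex unitary matrices, and let $\mu$ be a Haar measure on $U(d)$. For orthonormal bases $X=(x_j)_{j=1}^d$ and $Z=(z_k)_{k=1}^d$ of a $d$-dimensional complex Hilbert space $H$ put $c_{jk}=|\langle x_j, z_k\rangle|^2$, let $c_{\max}=\max_{j,k}c_{jk}$, and let $c_2$ be the second largest of the $d^2$ entries $c_{jk}$, counted with multiplicity (so $c_2=c_{\max}$ if the maximum is attained at more than one pair $(j,k)$). Put $$q_{\mathrm{MU}}=\log_2\frac1{c_{\max}},\qquad q'=q_{\mathrm{MU}}+\tfrac12\bigl(1-\sqrt{c_{\max}}\bigr)\log_2\frac{c_{\max}}{c_2}.$$ For $U\in U(d)$ and an orthonormal basis $e=(e_i)$ of $H$, let $Ue$ denote the orthonormal basis whose $j$-th vector is $\sum_i U_{ij}e_i$. 1. For $\mu$-almost every $U\in U(d)$, $|U_{ij}|\neq|U_{kl}|$ for all $(i,j)\neq(k,l)$. 2. For almost all choices of two orthonormal bases $X,Z$ of $H$ one has $c_2<c_{\max}<1$ and $q'>q_{\mathrm{MU}}$. Here "almost all" holds in both of the following senses: (a)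 for every fixed orthonormal basis $Z$ of $H$, for $X=UZ$ with $\mu$-almost every $U\in U(d)$; (b) for every fixed orthonormal basis $e$ of $H$, for $X=Ve$ and $Z=We$ with $(\mu\times\mu)$-almost every $(V,W)\in U(d)\times U(d)$. -/

import Mathlib

open MeasureTheory

noncomputable section

/-- The unitary group `U(d)` carries its Borel sigma-algebra, for the subspace topology
inherited from the complex `d × d` matrices. -/
instance unitaryMeasurableSpace (d : ℕ) :
    MeasurableSpace (Matrix.unitaryGroup (Fin d) ℂ) :=
  borel _

instance unitaryBorelSpace (d : ℕ) : BorelSpace (Matrix.unitaryGroup (Fin d) ℂ) :=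
  ⟨rfl⟩

section Bases

variable {d : ℕ} {H : Type*} [NormedAddCommGroup H] [InnerProductSpace ℂ H]

/-- The `j`-th vector `∑ i, U i j • e i` of the image of the orthonormal basis `e` under the
unitary operator whose matrix in the basis `e` is `U`. -/
def rotatedVector (U : Matrix.unitaryGroup (Fin d) ℂ) (e : OrthonormalBasis (Fin d) ℂ H)
    (j : Fin d) : H :=
  ∑ i, (U : Matrix (Fin d) (Fin d) ℂ) i j • e i

lemma orthonormal_rotatedVector (U : Matrix.unitaryGroup (Fin d) ℂ)
    (e : OrthonormalBasis (Fin d) ℂ H) : Orthonormal ℂ (rotatedVector U e) := by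
  rw [orthonormal_iff_ite]
  intro j k
  have h := congrFun (congrFun (Matrix.mem_unitaryGroup_iff'.mp U.2) j) k
  rw [Matrix.one_apply] at h
  rw [← h]
  simp only [rotatedVector]
  rw [Orthonormal.inner_sum e.orthonormal]
  simp [Matrix.mul_apply, Matrix.star_apply]

/-- The orthonormal basis obtained by applying to the orthonormal basis `e` the unitary operator
whose matrix in the basis `e` is `U`. -/
def rotatedBasis (U : Matrix.unitaryGroup (Fin d) ℂ) (e : OrthonormalBasis (Fin d) ℂ H) :
    OrthonormalBasis (Fin d) ℂ H :=
  OrthonormalBasis.mk (orthonormal_rotatedVector U e) (by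
    have : FiniteDimensional ℂ H := e.toBasis.finiteDimensional_of_finite
    rw [(orthonormal_rotatedVector U e).linearIndependent.span_eq_top_of_card_eq_finrank'
      (Module.finrank_eq_card_basis e.toBasis).symm])

/-- The overlap `c_{jk} = |⟨x_j, z_k⟩|²` of two orthonormal bases. -/
def overlap (X Z : OrthonormalBasis (Fin d) ℂ H) (p : Fin d × Fin d) : ℝ :=
  ‖inner ℂ (X p.1) (Z p.2)‖ ^ 2

/-- `c_max`, the largest entry of the overlap matrix. -/
def cMax (X Z : OrthonormalBasis (Fin d) ℂ H) : ℝ :=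
  ⨆ p : Fin d × Fin d, overlap X Z p

/-- The list of all `d²` entries of the overlap matrix, with repetitions, in non-increasing
order. -/
def sortedOverlaps (X Z : OrthonormalBasis (Fin d) ℂ H) : List ℝ :=
  ((Finset.univ : Finset (Fin d × Fin d)).val.map (overlap X Z)).sort (· ≥ ·)

/-- `c_2`, the second largest entry of the overlap matrix, counted with multiplicity (so it equals
`c_max` when the maximum is attained at more than one position). The default value `0` is only
used when `d ≤ 1`, where there is no second entry. -/
def cSecond (X Z : OrthonormalBasis (Fin d) ℂ H) : ℝ :=
  (sortedOverlaps X Z).getD 1 0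

/-- The Maassen-Uffink parameter `q_MU = log₂ (1 / c_max)`. -/
def qMU (X Z : OrthonormalBasis (Fin d) ℂ H) : ℝ :=
  Real.logb 2 (1 / cMax X Z)

/-- The improved parameter `q' = q_MU + (1/2) (1 - √c_max) log₂ (c_max / c_2)`. -/
def qPrime (X Z : OrthonormalBasis (Fin d) ℂ H) : ℝ :=
  qMU X Z + (1 / 2) * (1 - Real.sqrt (cMax X Z)) * Real.logb 2 (cMax X Z / cSecond X Z)

end Bases

end

/-!
A null set of a left-invariant measure on a group `G` can be recognised along a curve `g : ℝ → G`:
by Fubini and invariance, a property `P` holds for almost every `U` as soon as, for every `U`, the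
translate `g t * U` satisfies `P` for almost every `t` (`ae_of_forall_ae_mul`). On the unitary group
two kinds of curves suffice: reflections mixing two rows of `U` through an angle `t`
(`Matrix.planeReflection`), and multiplication of one row by a phase (`Matrix.phaseRotation`). Along
them every quantity of interest has the form `A cos (ω t) + B sin (ω t)`, a real-analytic function
of `t` which, unless `A = B = 0`, takes any given value on a null set only (`ae_trig_ne`).

The degenerate cases `A = B = 0` are removed one after the other.
* Reflecting rows `i` and `m` shows that `U i j = 0` with `U m j ≠ 0` is a null event; no column of
  `U` vanishes, so all entries are almost surely nonzero (`Matrix.ae_apply_ne_zero`).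
* Rotating the phase of row `i` then gives `Re (U i j * conj (U k j)) ≠ 0`
  (`Matrix.ae_re_mul_star_ne_zero`).
* Reflecting rows `i` and `k` moves the pair
  `((|U i j|² - |U k j|²) / 2, Re (U i j * conj (U k j)))` along a circle around the origin; it is
  nonzero by the previous step, so its first coordinate is almost surely nonzero
  (`Matrix.ae_norm_apply_ne_same_col`).
* If `d ≥ 3`, a third row `m` is available. Reflecting rows `i` and `m` changes `|U i j|` and leaves
  `|U k l|` fixed, hence `|U i j| ≠ |U k l|` almost surely whenever `i ≠ k`
  (`Matrix.ae_norm_apply_ne_of_row_ne`).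
* Entries in the same row are handled by inversion, which preserves Haar null sets.

The overlaps of `U Z` with `Z` are the squared moduli of the entries of `U`, and those of `V e` with
`W e` are the squared moduli of the entries of `V⁻¹ * W`, where `(V, W) ↦ V⁻¹ * W` pulls null sets
back to null sets. Hence almost surely all overlaps are positive and pairwise distinct. This forces
`0 < c₂ < c_max`, and `c_max < 1` because each row of the overlap matrix sums to one, which makes the
correction term in `q'` strictly positive.
-/

open Filter Topology

/-! ### Null sets detected along curves -/

/-- By Fubini some single `t` works for almost every `U`, and left translation by `g t` preserves
null sets. -/
theorem ae_of_forall_ae_mul {G : Type*} [Group G] [TopologicalSpace G] [IsTopologicalGroup G]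
    [SecondCountableTopology G] [MeasurableSpace G] [BorelSpace G]
    (μ : Measure G) [SFinite μ] [μ.IsMulLeftInvariant] {g : ℝ → G} (hg : Continuous g)
    {P : G → Prop} (hP : MeasurableSet {U | P U})
    (h : ∀ U, ∀ᵐ t : ℝ, P (g t * U)) : ∀ᵐ U ∂μ, P U := by
  have hmeas : Measurable fun q : G × ℝ => g q.2 * q.1 :=
    ((hg.comp continuous_snd).mul continuous_fst).measurable
  have h' : ∀ᵐ t : ℝ, ∀ᵐ U ∂μ, P (g t * U) :=
    (Measure.ae_ae_comm (p := fun U t => P (g t * U)) (hmeas hP)).mp (Eventually.of_forall h)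
  obtain ⟨t, ht⟩ := h'.exists
  exact (eventually_mul_left_iff μ (g t)).mp ht

theorem ae_trig_ne {A B : ℝ} (hAB : A ≠ 0 ∨ B ≠ 0) (C : ℝ) {ω : ℝ} (hω : ω ≠ 0) :
    ∀ᵐ t : ℝ, A * Real.cos (ω * t) + B * Real.sin (ω * t) ≠ C := by
  set f : ℝ → ℝ := fun t => A * Real.cos (ω * t) + B * Real.sin (ω * t) - C with hf
  have hana : AnalyticOnNhd ℝ f Set.univ := fun t _ => by fun_prop
  -- The values at the angles `0`, `π` and `π / 2` determine `C`, `A` and `B`.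
  have hne : ∃ t, f t ≠ 0 := by
    by_contra! h
    have h0 : A - C = 0 := by simpa [hf] using h 0
    have h1 : -A - C = 0 := by simpa [hf, mul_div_cancel₀ _ hω] using h (Real.pi / ω)
    have h2 : B - C = 0 := by simpa [hf, mul_div_cancel₀ _ hω] using h ((Real.pi / 2) / ω)
    rcases hAB with hA | hB
    · exact hA (by linarith)
    · exact hB (by linarith)
  obtain ⟨x, hx⟩ := hne
  have := hana.preimage_zero_mem_codiscrete hx
  have h3 := ae_restrict_le_codiscreteWithin (μ := (volume : Measure ℝ)) MeasurableSet.univ this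
  rw [Measure.restrict_univ] at h3
  filter_upwards [h3] with t ht hC
  exact ht (by simp [hf, hC])

theorem ae_cos_smul_add_sin_smul_ne_zero {a b : ℂ} (h : a ≠ 0 ∨ b ≠ 0) :
    ∀ᵐ t : ℝ, (Real.cos t : ℂ) * a + (Real.sin t : ℂ) * b ≠ 0 := by
  have key : (a.re ≠ 0 ∨ b.re ≠ 0) ∨ (a.im ≠ 0 ∨ b.im ≠ 0) := by
    by_contra! hc
    obtain ⟨⟨h1, h2⟩, h3, h4⟩ := hc
    rcases h with h | h
    · exact h (Complex.ext h1 h3)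
    · exact h (Complex.ext h2 h4)
  rcases key with k | k
  · filter_upwards [ae_trig_ne k 0 one_ne_zero] with t ht h0
    apply ht
    simpa [mul_comm, -Complex.ofReal_cos, -Complex.ofReal_sin] using congrArg Complex.re h0
  · filter_upwards [ae_trig_ne k 0 one_ne_zero] with t ht h0
    apply ht
    simpa [mul_comm, -Complex.ofReal_cos, -Complex.ofReal_sin] using congrArg Complex.im h0

/-- With the next two lemmas: under a rotation of `(a, b)` through the angle `t`, the pair
`((‖a‖² - ‖b‖²) / 2, Re (a * conj b))` is rotated through the angle `2 t`, while `‖a‖² + ‖b‖²` is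
unchanged. -/
theorem norm_sq_cos_mul_add_sin_mul (a b : ℂ) (t : ℝ) :
    ‖(Real.cos t : ℂ) * a + (Real.sin t : ℂ) * b‖ ^ 2 =
      (‖a‖ ^ 2 + ‖b‖ ^ 2) / 2 + ((‖a‖ ^ 2 - ‖b‖ ^ 2) / 2 * Real.cos (2 * t) +
        (a * star b).re * Real.sin (2 * t)) := by
  rw [Real.cos_two_mul, Real.sin_two_mul]
  simp only [Complex.sq_norm, Complex.normSq_apply, Complex.add_re, Complex.add_im,
    Complex.mul_re, Complex.mul_im, Complex.ofReal_re, Complex.ofReal_im, Complex.star_def,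
    Complex.conj_re, Complex.conj_im]
  linear_combination (b.re ^ 2 + b.im ^ 2) * Real.sin_sq t

theorem norm_sq_cos_mul_sub_sin_mul (a b : ℂ) (t : ℝ) :
    ‖(Real.cos t : ℂ) * b - (Real.sin t : ℂ) * a‖ ^ 2 =
      (‖a‖ ^ 2 + ‖b‖ ^ 2) / 2 - ((‖a‖ ^ 2 - ‖b‖ ^ 2) / 2 * Real.cos (2 * t) +
        (a * star b).re * Real.sin (2 * t)) := by
  have h : (b * star (-a)).re = -(a * star b).re := by
    simp only [star_neg, mul_neg, Complex.neg_re, Complex.mul_re, Complex.star_def,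
      Complex.conj_re, Complex.conj_im]
    ring
  rw [sub_eq_add_neg, ← mul_neg, norm_sq_cos_mul_add_sin_mul, norm_neg, h]
  ring

theorem re_rotated_mul_star_rotated (a b : ℂ) (t : ℝ) :
    (((Real.cos t : ℂ) * a + (Real.sin t : ℂ) * b) *
      star ((Real.cos t : ℂ) * b - (Real.sin t : ℂ) * a)).re =
      (a * star b).re * Real.cos (2 * t) -
        (‖a‖ ^ 2 - ‖b‖ ^ 2) / 2 * Real.sin (2 * t) := by
  rw [Real.cos_two_mul, Real.sin_two_mul]
  simp only [Complex.sq_norm, Complex.normSq_apply, Complex.add_re, Complex.add_im, Complex.sub_re,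
    Complex.sub_im, Complex.mul_re, Complex.mul_im, Complex.ofReal_re, Complex.ofReal_im,
    Complex.star_def, Complex.conj_re, Complex.conj_im]
  linear_combination -(a.re * b.re + a.im * b.im) * Real.sin_sq t

/-! ### Curves of unitary matrices -/

namespace Matrix

variable {n : Type*} [Fintype n] [DecidableEq n]

/-- This makes Haar measures on the unitary group `σ`-finite, as Fubini requires. -/
instance : SigmaCompactSpace (unitaryGroup n ℂ) := by
  have hc : IsClosed {A : Matrix n n ℂ | A ∈ unitaryGroup n ℂ} := by
    simp only [mem_unitaryGroup_iff]
    exact isClosed_eq (by fun_prop) continuous_const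
  have : SigmaCompactSpace (Matrix n n ℂ) := inferInstanceAs (SigmaCompactSpace (n → n → ℂ))
  exact hc.isClosedEmbedding_subtypeVal.sigmaCompactSpace

/-- The unit vector at angle `t / 2` in the real plane spanned by the basis vectors `i` and `k`. -/
noncomputable def planeVector (i k : n) (t : ℝ) : n → ℂ :=
  Pi.single i (Real.cos (t / 2) : ℂ) + Pi.single k (Real.sin (t / 2) : ℂ)

/-- The reflection `1 - 2 v vᵀ` in the hyperplane orthogonal to `v = planeVector i k t`. The half
angle in `v` makes it act on the rows `i` and `k` by the cosine and sine of `t`. -/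
noncomputable def planeReflection {i k : n} (hik : i ≠ k) (t : ℝ) : unitaryGroup n ℂ :=
  ⟨1 - (2 : ℂ) • vecMulVec (planeVector i k t) (planeVector i k t), by
    set v := planeVector i k t with hv
    have hs : star v = v := by
      ext m
      simp only [hv, planeVector, Pi.star_apply, Pi.add_apply, Pi.single_apply]
      split_ifs <;> simp [-Complex.ofReal_cos, -Complex.ofReal_sin]
    have hvv : v ⬝ᵥ v = 1 := by
      simp only [hv, planeVector, add_dotProduct, single_dotProduct, Pi.add_apply,
        Pi.single_eq_same, Pi.single_eq_of_ne hik, Pi.single_eq_of_ne hik.symm]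
      norm_cast
      linear_combination Real.cos_sq_add_sin_sq (t / 2)
    have hstar : star (vecMulVec v v) = vecMulVec v v := by
      rw [star_eq_conjTranspose, conjTranspose_vecMulVec, hs]
    have hsq : vecMulVec v v * vecMulVec v v = vecMulVec v v := by
      rw [vecMulVec_mul_vecMulVec, hvv, one_smul]
    rw [mem_unitaryGroup_iff, star_sub, star_one, star_smul, hstar]
    simp only [star_ofNat, sub_mul, mul_sub, one_mul, mul_one, smul_mul_assoc, mul_smul_comm, hsq]
    module⟩

theorem planeReflection_mul_apply {i k : n} (hik : i ≠ k) (t : ℝ) (U : unitaryGroup n ℂ)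
    (m j : n) :
    (planeReflection hik t * U : unitaryGroup n ℂ) m j = U m j -
      2 * planeVector i k t m *
        ((Real.cos (t / 2) : ℂ) * U i j + (Real.sin (t / 2) : ℂ) * U k j) := by
  change ((1 - (2 : ℂ) • vecMulVec (planeVector i k t) (planeVector i k t)) *
    (U : Matrix n n ℂ)) m j = _
  rw [sub_mul, one_mul, smul_mul, vecMulVec_mul]
  simp [vecMulVec_apply, planeVector, add_vecMul, mul_assoc]

theorem planeReflection_mul_apply_fst {i k : n} (hik : i ≠ k) (t : ℝ) (U : unitaryGroup n ℂ)
    (j : n) :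
    (planeReflection hik t * U : unitaryGroup n ℂ) i j =
      -((Real.cos t : ℂ) * U i j + (Real.sin t : ℂ) * U k j) := by
  have hc : Real.cos t = 2 * Real.cos (t / 2) ^ 2 - 1 := by
    rw [← Real.cos_two_mul]; ring_nf
  have hs : Real.sin t = 2 * Real.sin (t / 2) * Real.cos (t / 2) := by
    rw [← Real.sin_two_mul]; ring_nf
  rw [planeReflection_mul_apply, hc, hs]
  simp only [planeVector, Pi.add_apply, Pi.single_eq_same, Pi.single_eq_of_ne hik]
  push_cast
  ring

theorem planeReflection_mul_apply_snd {i k : n} (hik : i ≠ k) (t : ℝ) (U : unitaryGroup n ℂ)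
    (j : n) :
    (planeReflection hik t * U : unitaryGroup n ℂ) k j =
      (Real.cos t : ℂ) * U k j - (Real.sin t : ℂ) * U i j := by
  have hc : Real.cos t = 1 - 2 * Real.sin (t / 2) ^ 2 := by
    rw [Real.sin_sq, ← mul_div_cancel₀ t two_ne_zero, Real.cos_two_mul]; ring_nf
  have hs : Real.sin t = 2 * Real.sin (t / 2) * Real.cos (t / 2) := by
    rw [← Real.sin_two_mul]; ring_nf
  rw [planeReflection_mul_apply, hc, hs]
  simp only [planeVector, Pi.add_apply, Pi.single_eq_same, Pi.single_eq_of_ne hik.symm]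
  push_cast
  ring

theorem planeReflection_mul_apply_of_ne {i k m : n} (hik : i ≠ k) (hi : m ≠ i) (hk : m ≠ k)
    (t : ℝ) (U : unitaryGroup n ℂ) (j : n) :
    (planeReflection hik t * U : unitaryGroup n ℂ) m j = U m j := by
  simp [planeReflection_mul_apply, planeVector, hi, hk]

theorem continuous_planeReflection {i k : n} (hik : i ≠ k) :
    Continuous (planeReflection hik) := by
  refine Continuous.subtype_mk ?_ _
  have : Continuous (planeVector i k) := by
    refine continuous_pi fun m => ?_
    simp only [planeVector, Pi.add_apply, Pi.single_apply]
    split_ifs <;> fun_prop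
  fun_prop

/-- The diagonal unitary matrix with entry `exp (i t)` at position `i` and `1` elsewhere. -/
noncomputable def phaseRotation (i : n) (t : ℝ) : unitaryGroup n ℂ :=
  ⟨diagonal (Function.update 1 i (Circle.exp t : ℂ)), by
    rw [mem_unitaryGroup_iff, star_eq_conjTranspose, diagonal_conjTranspose,
      diagonal_mul_diagonal, ← diagonal_one]
    congr 1
    ext m
    by_cases h : m = i
    · subst h
      simp [Complex.mul_conj, Circle.normSq_coe, -Circle.coe_exp]
    · simp [h]⟩

theorem phaseRotation_mul_apply (i : n) (t : ℝ) (U : unitaryGroup n ℂ) (m j : n) :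
    (phaseRotation i t * U : unitaryGroup n ℂ) m j =
      Function.update (1 : n → ℂ) i (Circle.exp t : ℂ) m * U m j := by
  change ((diagonal (Function.update (1 : n → ℂ) i (Circle.exp t : ℂ)) : Matrix n n ℂ) *
    (U : Matrix n n ℂ)) m j = _
  rw [diagonal_mul]

theorem continuous_phaseRotation (i : n) : Continuous (phaseRotation (n := n) i) := by
  refine Continuous.subtype_mk ?_ _
  refine Continuous.matrix_diagonal ?_
  exact continuous_const.update i (by fun_prop)

end Matrix

/-! ### Almost sure properties of the entries of a unitary matrix -/

namespace Matrix

variable {d : ℕ} (μ : Measure (unitaryGroup (Fin d) ℂ)) [μ.IsHaarMeasure]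

instance : SecondCountableTopology (unitaryGroup (Fin d) ℂ) := by
  have : SecondCountableTopology (Matrix (Fin d) (Fin d) ℂ) :=
    inferInstanceAs (SecondCountableTopology (Fin d → Fin d → ℂ))
  exact TopologicalSpace.Subtype.secondCountableTopology _

local notation "𝕌" => unitaryGroup (Fin d) ℂ

theorem continuous_unitaryGroup_apply (i j : Fin d) :
    Continuous fun U : 𝕌 => (U : Matrix (Fin d) (Fin d) ℂ) i j :=
  continuous_subtype_val.matrix_elem i j

theorem exists_unitaryGroup_apply_ne_zero (U : 𝕌) (j : Fin d) : ∃ m, U m j ≠ 0 := by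
  by_contra! h
  have h1 := congrFun (congrFun (mem_unitaryGroup_iff'.mp U.2) j) j
  simp [mul_apply, h] at h1

theorem ae_apply_ne_zero (i j : Fin d) : ∀ᵐ U ∂μ, U i j ≠ 0 := by
  have key : ∀ m, ∀ᵐ U ∂μ, U i j = 0 → U m j = 0 := by
    intro m
    rcases eq_or_ne i m with rfl | him
    · exact Eventually.of_forall fun _ h => h
    refine ae_of_forall_ae_mul μ (continuous_planeReflection him) ?_ fun U => ?_
    · have hc := continuous_unitaryGroup_apply (d := d)
      exact (((hc i j).measurable (measurableSet_singleton 0)).imp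
        ((hc m j).measurable (measurableSet_singleton 0)))
    · by_cases h : U i j ≠ 0 ∨ U m j ≠ 0
      · filter_upwards [ae_cos_smul_add_sin_smul_ne_zero h] with t ht h0
        rw [planeReflection_mul_apply_fst, neg_eq_zero] at h0
        exact absurd h0 ht
      -- If both entries vanish, they vanish along the whole curve.
      · push Not at h
        refine Eventually.of_forall fun t _ => ?_
        rw [planeReflection_mul_apply_snd, h.1, h.2]
        simp
  filter_upwards [ae_all_iff.mpr key] with U hU h0
  obtain ⟨m, hm⟩ := exists_unitaryGroup_apply_ne_zero U j
  exact hm (hU m h0)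

theorem ae_re_mul_star_ne_zero {i k : Fin d} (hik : i ≠ k) (j : Fin d) :
    ∀ᵐ U ∂μ, (U i j * star (U k j)).re ≠ 0 := by
  have hc := continuous_unitaryGroup_apply (d := d)
  have key : ∀ᵐ U ∂μ, U i j * star (U k j) ≠ 0 → (U i j * star (U k j)).re ≠ 0 := by
    refine ae_of_forall_ae_mul μ (continuous_phaseRotation i) ?_ fun U => ?_
    · have h1 : Continuous fun U : 𝕌 => U i j * star (U k j) := (hc i j).mul (hc k j).star
      exact (h1.measurable (measurableSet_singleton 0).compl).imp
        ((Complex.continuous_re.comp h1).measurable (measurableSet_singleton 0).compl)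
    · simp only [phaseRotation_mul_apply, Function.update_self, Function.update_of_ne hik.symm,
        Pi.one_apply, one_mul, mul_assoc]
      generalize U i j * star (U k j) = w
      by_cases hw : w = 0
      · simp [hw]
      have hw' : w.re ≠ 0 ∨ -w.im ≠ 0 := by
        by_contra! h
        exact hw (Complex.ext h.1 (by simpa using h.2))
      filter_upwards [ae_trig_ne hw' 0 one_ne_zero] with t ht _ h0
      apply ht
      rw [Circle.coe_exp, Complex.mul_re, Complex.exp_ofReal_mul_I_re,
        Complex.exp_ofReal_mul_I_im] at h0
      rw [one_mul]
      linarith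
  filter_upwards [key, ae_apply_ne_zero μ i j, ae_apply_ne_zero μ k j] with U h h1 h2
  exact h (mul_ne_zero h1 (star_ne_zero.mpr h2))

theorem ae_norm_apply_ne_same_col {i k : Fin d} (hik : i ≠ k) (j : Fin d) :
    ∀ᵐ U ∂μ, ‖U i j‖ ≠ ‖U k j‖ := by
  have hc := continuous_unitaryGroup_apply (d := d)
  -- If `((‖U i j‖² - ‖U k j‖²) / 2, Re (U i j * conj (U k j)))` vanishes, it vanishes along the
  -- whole curve, and the premise fails there.
  have key : ∀ᵐ U ∂μ, (U i j * star (U k j)).re ≠ 0 → ‖U i j‖ ≠ ‖U k j‖ := by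
    refine ae_of_forall_ae_mul μ (continuous_planeReflection hik) ?_ fun U => ?_
    · have h1 : Continuous fun U : 𝕌 => (U i j * star (U k j)).re :=
        Complex.continuous_re.comp ((hc i j).mul (hc k j).star)
      exact (h1.measurable (measurableSet_singleton 0).compl).imp
        (isOpen_ne_fun (hc i j).norm (hc k j).norm).measurableSet
    · by_cases h : (‖U i j‖ ^ 2 - ‖U k j‖ ^ 2) / 2 ≠ 0 ∨ (U i j * star (U k j)).re ≠ 0
      · filter_upwards [ae_trig_ne h 0 two_ne_zero] with t ht _ heq
        have heq2 := congrArg (· ^ 2) heq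
        simp only [planeReflection_mul_apply_fst, planeReflection_mul_apply_snd, norm_neg,
          norm_sq_cos_mul_add_sin_mul, norm_sq_cos_mul_sub_sin_mul] at heq2
        exact ht (by linarith)
      · push Not at h
        refine Eventually.of_forall fun t hre => absurd ?_ hre
        rw [planeReflection_mul_apply_fst, planeReflection_mul_apply_snd, neg_mul, Complex.neg_re,
          re_rotated_mul_star_rotated, h.1, h.2]
        simp
  filter_upwards [key, ae_re_mul_star_ne_zero μ hik j] with U h h1 using h h1

/-- The columns `j` and `l` may coincide. The bound `3 ≤ d` provides a row other than `i` and `k`;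
for `d = 2` the claim fails, since then the two diagonal entries have equal modulus. -/
theorem ae_norm_apply_ne_of_row_ne (hd : 3 ≤ d) {i k : Fin d} (hik : i ≠ k)
    (j l : Fin d) :
    ∀ᵐ U ∂μ, ‖U i j‖ ≠ ‖U k l‖ := by
  have hc := continuous_unitaryGroup_apply (d := d)
  obtain ⟨m, hmi, hmk⟩ : ∃ m, m ≠ i ∧ m ≠ k := by
    obtain ⟨m, hm⟩ := Finset.exists_mem_notMem_of_card_lt_card (s := {i, k}) (t := Finset.univ)
      (lt_of_le_of_lt Finset.card_le_two (by simpa using Nat.lt_of_succ_le hd))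
    exact ⟨m, by simpa using hm⟩
  -- If `‖U i j‖` is constant along the curve, then so is `‖U m j‖`, and the two are equal.
  have key : ∀ᵐ U ∂μ, ‖U i j‖ ≠ ‖U m j‖ → ‖U i j‖ ≠ ‖U k l‖ := by
    refine ae_of_forall_ae_mul μ (continuous_planeReflection hmi.symm) ?_ fun U => ?_
    · exact ((isOpen_ne_fun (hc i j).norm (hc m j).norm).measurableSet.imp
        (isOpen_ne_fun (hc i j).norm (hc k l).norm).measurableSet)
    · by_cases h : (‖U i j‖ ^ 2 - ‖U m j‖ ^ 2) / 2 ≠ 0 ∨ (U i j * star (U m j)).re ≠ 0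
      · filter_upwards [ae_trig_ne h (‖U k l‖ ^ 2 - (‖U i j‖ ^ 2 + ‖U m j‖ ^ 2) / 2)
          two_ne_zero] with t ht _ heq
        have heq2 := congrArg (· ^ 2) heq
        simp only [planeReflection_mul_apply_fst, planeReflection_mul_apply_of_ne hmi.symm hik.symm
          hmk.symm, norm_neg, norm_sq_cos_mul_add_sin_mul] at heq2
        exact ht (by linarith)
      · push Not at h
        refine Eventually.of_forall fun t hne => absurd ?_ hne
        rw [← sq_eq_sq₀ (norm_nonneg _) (norm_nonneg _), planeReflection_mul_apply_fst,
          planeReflection_mul_apply_snd, norm_neg, norm_sq_cos_mul_add_sin_mul,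
          norm_sq_cos_mul_sub_sin_mul, h.1, h.2]
        simp
  filter_upwards [key, ae_norm_apply_ne_same_col μ hmi.symm j] with U h h1 using h h1

theorem ae_norm_apply_ne (hd : 3 ≤ d) {p q : Fin d × Fin d} (hpq : p ≠ q) :
    ∀ᵐ U ∂μ, ‖U p.1 p.2‖ ≠ ‖U q.1 q.2‖ := by
  rcases eq_or_ne p.1 q.1 with h1 | h1
  · have h2 : p.2 ≠ q.2 := fun h2 => hpq (Prod.ext h1 h2)
    filter_upwards [(quasiMeasurePreserving_inv μ).ae
      (ae_norm_apply_ne_same_col μ h2 p.1)] with U hU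
    have hU' : ‖(U⁻¹ : 𝕌) p.2 p.1‖ ≠ ‖(U⁻¹ : 𝕌) q.2 p.1‖ := hU
    simpa [h1, star_apply] using hU'
  · exact ae_norm_apply_ne_of_row_ne μ hd h1 p.2 q.2

end Matrix

/-! ### Overlaps of orthonormal bases -/

section

variable {d : ℕ} {H : Type*} [NormedAddCommGroup H] [InnerProductSpace ℂ H]

theorem overlap_rotatedBasis_self (U : Matrix.unitaryGroup (Fin d) ℂ)
    (Z : OrthonormalBasis (Fin d) ℂ H) (p : Fin d × Fin d) :
    overlap (rotatedBasis U Z) Z p = ‖U p.2 p.1‖ ^ 2 := by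
  simp [overlap, rotatedBasis, rotatedVector, Z.inner_eq_ite]

theorem overlap_rotatedBasis_rotatedBasis (V W : Matrix.unitaryGroup (Fin d) ℂ)
    (e : OrthonormalBasis (Fin d) ℂ H) (p : Fin d × Fin d) :
    overlap (rotatedBasis V e) (rotatedBasis W e) p = ‖(V⁻¹ * W) p.1 p.2‖ ^ 2 := by
  simp only [overlap, rotatedBasis, OrthonormalBasis.coe_mk, rotatedVector]
  rw [Orthonormal.inner_sum e.orthonormal]
  simp [Matrix.mul_apply, Matrix.star_apply]

variable {X Z : OrthonormalBasis (Fin d) ℂ H}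

theorem sum_overlap (X Z : OrthonormalBasis (Fin d) ℂ H) (j : Fin d) :
    ∑ k, overlap X Z (j, k) = 1 := by
  simp [overlap, Z.sum_sq_norm_inner_left]

/-- The row of the overlap matrix containing the maximum sums to one and has a further positive
entry. -/
theorem cMax_lt_one (hd : 2 ≤ d) (hpos : ∀ p, 0 < overlap X Z p) : cMax X Z < 1 := by
  have : NeZero d := ⟨by omega⟩
  have : Nontrivial (Fin d) := Fin.nontrivial_iff_two_le.mpr hd
  obtain ⟨⟨j, k⟩, hp⟩ := exists_eq_ciSup_of_finite (f := overlap X Z)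
  obtain ⟨l, hl⟩ := exists_ne k
  rw [cMax, ← hp, ← sum_overlap X Z j]
  exact Finset.single_lt_sum hl (Finset.mem_univ k) (Finset.mem_univ l) (hpos _)
    fun _ _ _ => (hpos _).le

theorem cSecond_pos_and_lt_cMax (hd : 2 ≤ d) (hpos : ∀ p, 0 < overlap X Z p)
    (hinj : Function.Injective (overlap X Z)) : 0 < cSecond X Z ∧ cSecond X Z < cMax X Z := by
  have hmem : ∀ c ∈ sortedOverlaps X Z, ∃ p, overlap X Z p = c := by
    simp [sortedOverlaps]
  have hnodup : (sortedOverlaps X Z).Nodup := by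
    rw [← Multiset.coe_nodup, sortedOverlaps, Multiset.sort_eq]
    exact Finset.univ.nodup.map hinj
  have hlen : (sortedOverlaps X Z).length = d * d := by
    simp [sortedOverlaps]
  have hsort : (sortedOverlaps X Z).Pairwise (· ≥ ·) := Multiset.pairwise_sort _ _
  unfold cSecond
  match hL : sortedOverlaps X Z with
  | [] => rw [hL] at hlen; simp at hlen; nlinarith
  | [a] => rw [hL] at hlen; simp at hlen; nlinarith
  | a :: b :: L =>
    rw [hL] at hmem hnodup hsort
    obtain ⟨p, hp⟩ := hmem a (by simp)
    obtain ⟨q, hq⟩ := hmem b (by simp)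
    have hba : b ≤ a := by simp at hsort; exact hsort.1.1
    have hne : b ≠ a := by simp at hnodup; tauto
    have ha : a ≤ cMax X Z := hp ▸ le_ciSup (Set.finite_range _).bddAbove p
    exact ⟨by simpa [← hq] using hpos q, by simpa using (lt_of_le_of_ne hba hne).trans_le ha⟩

/-- Positivity of `c₂` matters: for `c₂ = 0` the quotient `c_max / c₂` and its logarithm take the
value `0`, and the correction term vanishes. -/
theorem qMU_lt_qPrime (h0 : 0 < cSecond X Z) (h1 : cSecond X Z < cMax X Z) (h2 : cMax X Z < 1) :
    qMU X Z < qPrime X Z := by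
  have hlog : 0 < Real.logb 2 (cMax X Z / cSecond X Z) :=
    Real.logb_pos one_lt_two ((one_lt_div h0).mpr h1)
  have hsqrt : Real.sqrt (cMax X Z) < 1 := (Real.sqrt_lt' one_pos).mpr (by simpa using h2)
  have : 0 < 1 - Real.sqrt (cMax X Z) := sub_pos.mpr hsqrt
  unfold qPrime
  have := mul_pos (mul_pos one_half_pos this) hlog
  linarith

theorem parameters_lt_of_overlap_eq (hd : 2 ≤ d) {a : Fin d × Fin d → ℂ} (ha : ∀ p, a p ≠ 0)
    (hinj : ∀ p q, p ≠ q → ‖a p‖ ≠ ‖a q‖) (h : ∀ p, overlap X Z p = ‖a p‖ ^ 2) :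
    cSecond X Z < cMax X Z ∧ cMax X Z < 1 ∧ qMU X Z < qPrime X Z := by
  have hpos : ∀ p, 0 < overlap X Z p := fun p => by
    rw [h]
    exact pow_pos (norm_pos_iff.mpr (ha p)) 2
  have hi : Function.Injective (overlap X Z) := fun p q hpq => by
    rw [h, h] at hpq
    by_contra hne
    exact hinj p q hne ((sq_eq_sq₀ (norm_nonneg _) (norm_nonneg _)).mp hpq)
  obtain ⟨h0, h1⟩ := cSecond_pos_and_lt_cMax hd hpos hi
  have h2 := cMax_lt_one hd hpos
  exact ⟨h1, h2, qMU_lt_qPrime h0 h1 h2⟩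

end

theorem mainTheorem11 (d : ℕ) (hd : 3 ≤ d)
    (μ : Measure (Matrix.unitaryGroup (Fin d) ℂ)) [μ.IsHaarMeasure] :
    -- Haar-almost every unitary has entries of pairwise distinct modulus
    (∀ᵐ U : Matrix.unitaryGroup (Fin d) ℂ ∂μ,
      ∀ p q : Fin d × Fin d, p ≠ q →
        ‖(U : Matrix (Fin d) (Fin d) ℂ) p.1 p.2‖ ≠ ‖(U : Matrix (Fin d) (Fin d) ℂ) q.1 q.2‖) ∧
    -- for every basis `Z`, and almost every unitary `U` connecting it to the basis `X = U Z`
    (∀ (H : Type*) [NormedAddCommGroup H] [InnerProductSpace ℂ H]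
      (Z : OrthonormalBasis (Fin d) ℂ H),
      ∀ᵐ U ∂μ,
        cSecond (rotatedBasis U Z) Z < cMax (rotatedBasis U Z) Z ∧
        cMax (rotatedBasis U Z) Z < 1 ∧
        qMU (rotatedBasis U Z) Z < qPrime (rotatedBasis U Z) Z) ∧
    -- for almost every pair of bases `X = V e`, `Z = W e`, with `(V, W)` a pair of unitaries
    (∀ (H : Type*) [NormedAddCommGroup H] [InnerProductSpace ℂ H]
      (e : OrthonormalBasis (Fin d) ℂ H),
      ∀ᵐ p ∂(μ.prod μ),
        cSecond (rotatedBasis p.1 e) (rotatedBasis p.2 e) <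
          cMax (rotatedBasis p.1 e) (rotatedBasis p.2 e) ∧
        cMax (rotatedBasis p.1 e) (rotatedBasis p.2 e) < 1 ∧
        qMU (rotatedBasis p.1 e) (rotatedBasis p.2 e) <
          qPrime (rotatedBasis p.1 e) (rotatedBasis p.2 e)) := by
  have hne : ∀ᵐ U ∂μ, ∀ p q : Fin d × Fin d, p ≠ q → ‖U p.1 p.2‖ ≠ ‖U q.1 q.2‖ :=
    ae_all_iff.mpr fun p => ae_all_iff.mpr fun q => by
      by_cases hpq : p = q
      · exact Eventually.of_forall fun _ h => absurd hpq h
      · exact (Matrix.ae_norm_apply_ne μ hd hpq).mono fun _ h _ => h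
  have h0 : ∀ᵐ U ∂μ, ∀ p : Fin d × Fin d, U p.1 p.2 ≠ 0 :=
    ae_all_iff.mpr fun p => Matrix.ae_apply_ne_zero μ p.1 p.2
  have hd2 : 2 ≤ d := by omega
  refine ⟨hne, fun H _ _ Z => ?_, fun H _ _ e => ?_⟩
  · filter_upwards [hne, h0] with U hU hU0
    exact parameters_lt_of_overlap_eq hd2 (a := fun p => U p.2 p.1) (fun p => hU0 p.swap)
      (fun p q hpq => hU p.swap q.swap (Prod.swap_injective.ne hpq))
      (overlap_rotatedBasis_self U Z)
  · filter_upwards [(quasiMeasurePreserving_inv_mul μ μ).ae hne,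
      (quasiMeasurePreserving_inv_mul μ μ).ae h0] with p hp hp0
    exact parameters_lt_of_overlap_eq hd2 hp0 hp (overlap_rotatedBasis_rotatedBasis p.1 p.2 e)
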